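/- For a finite connected graph $G$ and vertices $u,v$ of $G$, let $R_G[u,v]$ denote the resistance distance, i.e. the effective resistance between $u$ and $v$ in the electric network obtained from $G$ by replacing each edge with a unit resistor. Let $D_r(G)=\max_{u,v\in V(G)}R_G[u,v]$ be the resistance diameter of $G$, and let $RD(G)$ be the set of resistance diametrical pairs of $G$, i.e. of all unordered pairs $[u,v]$ of vertices with $R_G[u,v]=D_r(G)$. For $n\ge 2$ let $P_n=a_1a_2\cdots a_n$ be the path on $n$ vertices, let $C_4=b_1b_2b_3b_4b_1$ be the $4$-cycle, and let $G_n=P_n\square C_4$ be their Cartesian product: its vertices are the $(a_i,b_j)$ with $1\le i\le n$, $1\le j\le 4$, and two vertices are adjacent if and only if they agree in one coordinate and are adjacent in the other. Then $$RD(G_n)=\big\{[(a_1,b_1),(a_n,b_3)],\ [(a_1,b_2),(a_n,b_4)],\ [(a_1,b_3),(a_n,b_1)],\ [(a_1,b_4),(a_n,b_2)]\big\}.$$ -/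

import Mathlib

namespace SimpleGraph

/-- The electric network of a finite graph `G`: every edge is a unit resistor. A function
`φ : V → ℝ` is a potential for a unit current entering at `u` and leaving at `v` if the
currents `φ w - φ x` along the edges `w x` (Ohm's law with resistance one) satisfy Kirchhoff's
current law: the net current flowing out of `w` into the network is the net external current
injected at `w`. -/
def IsUnitCurrentPotential {V : Type*} [Fintype V] (G : SimpleGraph V) (u v : V)
    (φ : V → ℝ) : Prop :=
  open Classical in
  ∀ w : V, (∑ x : V, if G.Adj w x then φ w - φ x else 0) =
    (if w = u then 1 else 0) - (if w = v then 1 else 0)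

open Classical in
/-- The resistance distance `R_G[u,v]` of a finite connected graph: the potential difference
between `u` and `v` when a unit current is sent from `u` to `v`. By
`existsUnique_resistance` this is well defined when `G` is connected (the value `0` of the second
branch is never used then). -/
noncomputable def resistanceDist {V : Type*} [Fintype V] (G : SimpleGraph V) (u v : V) : ℝ :=
  if h : ∃ φ : V → ℝ, G.IsUnitCurrentPotential u v φ then h.choose u - h.choose v else 0

/-- The resistance diameter `D_r(G)`: the maximum of `R_G[u,v]` over all pairs of vertices. -/
noncomputable def resistanceDiam {V : Type*} [Fintype V] (G : SimpleGraph V) : ℝ :=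
  ⨆ p : V × V, G.resistanceDist p.1 p.2

/-- The set `RD(G)` of resistance diametrical pairs of `G`, as unordered pairs `[u, v]`. -/
def resistanceDiametricalPairs {V : Type*} [Fintype V] (G : SimpleGraph V) : Set (Sym2 V) :=
  {e | ∃ u v : V, e = s(u, v) ∧ G.resistanceDist u v = G.resistanceDiam}

/-- The block tower graph `G_n = P_n □ C_4`. The vertex `(a_i, b_j)` is `(i - 1, j - 1)`. -/
def blockTower (n : ℕ) : SimpleGraph (Fin n × Fin 4) :=
  (pathGraph n).boxProd (cycleGraph 4)

open Classical in
theorem isUnitCurrentPotential_iff {V : Type*} [Fintype V] (G : SimpleGraph V) (u v : V)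
    (φ : V → ℝ) : G.IsUnitCurrentPotential u v φ ↔
      Matrix.mulVec (G.lapMatrix ℝ) φ = Pi.single u 1 - Pi.single v 1 := by
  rw [funext_iff]
  refine forall_congr' fun w => ?_
  rw [lapMatrix_mulVec_apply]
  have h : (∑ x : V, if G.Adj w x then φ w - φ x else 0) =
      G.degree w * φ w - ∑ x ∈ G.neighborFinset w, φ x := by
    rw [← Finset.sum_filter, Finset.sum_sub_distrib, Finset.sum_const, nsmul_eq_mul,
      ← neighborFinset_eq_filter, card_neighborFinset_eq_degree]
  simp only [Pi.sub_apply, Pi.single_apply]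
  rw [← h]

/-- The potential difference does not depend on the chosen potential. -/
theorem IsUnitCurrentPotential.sub_eq {V : Type*} [Fintype V] {G : SimpleGraph V}
    (hG : G.Connected) {u v : V} {φ ψ : V → ℝ} (hφ : G.IsUnitCurrentPotential u v φ)
    (hψ : G.IsUnitCurrentPotential u v ψ) : φ u - φ v = ψ u - ψ v := by
  classical
  rw [isUnitCurrentPotential_iff] at hφ hψ
  have h : Matrix.mulVec (G.lapMatrix ℝ) (φ - ψ) = 0 := by
    rw [Matrix.mulVec_sub, hφ, hψ, sub_self]
  have := (lapMatrix_mulVec_eq_zero_iff_forall_reachable G).1 h u v (hG.preconnected u v)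
  simp only [Pi.sub_apply] at this
  linarith

/-- In a connected graph every unit current has a potential. -/
theorem exists_isUnitCurrentPotential {V : Type*} [Fintype V] {G : SimpleGraph V}
    (hG : G.Connected) (u v : V) : ∃ φ, G.IsUnitCurrentPotential u v φ := by
  classical
  obtain ⟨r⟩ := hG.nonempty
  have hcol (φ : V → ℝ) : ∑ w, Matrix.mulVec (G.lapMatrix ℝ) φ w = 0 := by
    have h := Matrix.dotProduct_mulVec (fun _ : V => (1 : ℝ)) (G.lapMatrix ℝ) φ
    rw [← Matrix.mulVec_transpose, (G.isSymm_lapMatrix (R := ℝ)).eq,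
      lapMatrix_mulVec_const_eq_zero] at h
    simpa [dotProduct] using h
  -- The operator `φ ↦ L φ + (∑ φ) • 1` is injective, hence surjective.
  let T : (V → ℝ) →ₗ[ℝ] (V → ℝ) :=
    { toFun := fun φ w => Matrix.mulVec (G.lapMatrix ℝ) φ w + ∑ x, φ x
      map_add' := fun φ ψ => by
        ext w; simp [Matrix.mulVec_add, Finset.sum_add_distrib]; ring
      map_smul' := fun c φ => by
        ext w; simp [Matrix.mulVec_smul, Finset.mul_sum, mul_add] }
  have hcard : (0 : ℝ) < Fintype.card V := by
    exact_mod_cast Fintype.card_pos_iff.2 ⟨r⟩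
  have hsum (φ : V → ℝ) : ∑ w, T φ w = Fintype.card V * ∑ x, φ x := by
    change ∑ w, (Matrix.mulVec (G.lapMatrix ℝ) φ w + ∑ x, φ x) = _
    rw [Finset.sum_add_distrib, hcol]
    simp
  have hinj : Function.Injective T := by
    rw [← LinearMap.ker_eq_bot, LinearMap.ker_eq_bot']
    intro φ hφ
    have h0 : ∑ x, φ x = 0 := by
      have := hsum φ
      rw [hφ] at this
      simpa [hcard.ne'] using this.symm
    have hL : Matrix.mulVec (G.lapMatrix ℝ) φ = 0 := by
      ext w
      have : Matrix.mulVec (G.lapMatrix ℝ) φ w + ∑ x, φ x = 0 := congrFun hφ w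
      simpa [h0] using this
    have hc := (lapMatrix_mulVec_eq_zero_iff_forall_reachable G).1 hL
    ext w
    have : ∑ x, φ x = Fintype.card V * φ w := by
      rw [Finset.sum_congr rfl fun x _ => hc x w (hG.preconnected x w)]
      simp
    rw [h0] at this
    simpa [hcard.ne'] using this.symm
  obtain ⟨φ, hφ⟩ := LinearMap.injective_iff_surjective.1 hinj (Pi.single u 1 - Pi.single v 1)
  have h0 : ∑ x, φ x = 0 := by
    have := hsum φ
    rw [hφ] at this
    simpa [hcard.ne'] using this.symm
  refine ⟨φ, (isUnitCurrentPotential_iff G u v φ).2 ?_⟩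
  ext w
  have : Matrix.mulVec (G.lapMatrix ℝ) φ w + ∑ x, φ x = _ := congrFun hφ w
  simpa [h0] using this

/-- In a connected graph the resistance distance is the potential difference of any potential for
a unit current. -/
theorem resistanceDist_eq {V : Type*} [Fintype V] {G : SimpleGraph V} (hG : G.Connected)
    {u v : V} {φ : V → ℝ} (hφ : G.IsUnitCurrentPotential u v φ) :
    G.resistanceDist u v = φ u - φ v := by
  have h : ∃ φ : V → ℝ, G.IsUnitCurrentPotential u v φ := ⟨φ, hφ⟩
  rw [resistanceDist, dif_pos h]
  exact h.choose_spec.sub_eq hG hφ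

theorem existsUnique_resistance {V : Type*} [Fintype V] {G : SimpleGraph V} (hG : G.Connected)
    (u v : V) : ∃! r : ℝ, ∃ φ : V → ℝ, G.IsUnitCurrentPotential u v φ ∧ r = φ u - φ v := by
  obtain ⟨φ, hφ⟩ := exists_isUnitCurrentPotential hG u v
  refine ⟨φ u - φ v, ⟨φ, hφ, rfl⟩, ?_⟩
  rintro _ ⟨ψ, hψ, rfl⟩
  exact hψ.sub_eq hG hφ

theorem blockTower_connected (n : ℕ) (hn : 1 ≤ n) : (blockTower n).Connected := by
  obtain ⟨m, rfl⟩ : ∃ m, n = m + 1 := ⟨n - 1, by omega⟩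
  exact (pathGraph_connected m).boxProd cycleGraph_connected

end SimpleGraph

/-! Fourier analysis on `C_4` splits the Laplacian of `P_n □ C_4` into path operators `L + r`, where
`r` is an eigenvalue 0, 2, 2, 4 of the cycle. The massless mode contributes the path distance, and
the others contribute the Green's functions `pathGreen 2` and `pathGreen 4`. This gives the closed
form `towerResistance` for four times the resistance.

Since the Green's function decreases in `r` (`pathGreen_lt`), opposite columns are strictly best for
any two levels. For opposite columns, moving the upper vertex one level further away strictly
increases the resistance (`towerResistance_two_lt_succ`); reflecting the path gives the same for the
lower vertex. So only opposite corners at the two ends attain the maximum. -/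

namespace SimpleGraph

/-! ### Laplacians of products, paths and the 4-cycle -/

open Classical in
/-- The combinatorial Laplacian of `f` at `w`. -/
noncomputable def outflow {V : Type*} [Fintype V] (G : SimpleGraph V) (f : V → ℝ) (w : V) : ℝ :=
  ∑ x : V, if G.Adj w x then f w - f x else 0

theorem outflow_nonpos_of_isMin {V : Type*} [Fintype V] (G : SimpleGraph V) {f : V → ℝ} {w : V}
    (h : ∀ x, f w ≤ f x) : G.outflow f w ≤ 0 := by
  refine Finset.sum_nonpos fun x _ => ?_
  split_ifs
  · linarith [h x]
  · rfl

/-- The minimum principle for the operator `L + r`. -/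
theorem pos_of_outflow_add_nonneg {V : Type*} [Fintype V] (G : SimpleGraph V)
    {f : V → ℝ} {r : ℝ} (hr : 0 < r) (h : ∀ w, 0 < G.outflow f w + r * f w) (v : V) : 0 < f v := by
  have : Nonempty V := ⟨v⟩
  obtain ⟨w, hw⟩ := Finite.exists_min f
  have h1 := outflow_nonpos_of_isMin G hw
  have h2 : 0 < r * f w := by linarith [h w]
  exact (pos_of_mul_pos_right h2 hr.le).trans_le (hw v)

theorem outflow_boxProd {V W : Type*} [Fintype V] [Fintype W] (G : SimpleGraph V)
    (H : SimpleGraph W) (f : V × W → ℝ) (p : V × W) :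
    (G.boxProd H).outflow f p =
      G.outflow (fun x => f (x, p.2)) p.1 + H.outflow (fun y => f (p.1, y)) p.2 := by
  classical
  obtain ⟨x, y⟩ := p
  have key : ∀ a b, (if (G.boxProd H).Adj (x, y) (a, b) then f (x, y) - f (a, b) else 0) =
      (if b = y then (if G.Adj x a then f (x, y) - f (a, b) else 0) else 0) +
      (if a = x then (if H.Adj y b then f (x, y) - f (a, b) else 0) else 0) := by
    intro a b
    rw [boxProd_adj]
    by_cases h1 : b = y
    · subst h1
      by_cases h2 : a = x <;> simp [h2]
    · by_cases h2 : a = x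
      · simp [h1, Ne.symm h1, h2]
      · simp [h1, Ne.symm h1, h2, Ne.symm h2]
  simp only [outflow, Fintype.sum_prod_type, key, Finset.sum_add_distrib]
  congr 1
  · exact Finset.sum_congr rfl fun a _ => by simp
  · rw [Finset.sum_comm]
    exact Finset.sum_congr rfl fun a _ => by simp

/-- Both free ends fit the interior formula: truncated subtraction gives `x - 1 = 0` at `x = 0`, and
`hf` cancels the missing edge at `N`. -/
theorem outflow_pathGraph {N : ℕ} (f : ℕ → ℝ) (hf : f (N + 1) = f N) (x : Fin (N + 1)) :
    (pathGraph (N + 1)).outflow (fun y => f y) x = 2 * f x - f (x - 1) - f (x + 1) := by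
  classical
  have key : ∀ y : Fin (N + 1), (if (pathGraph (N + 1)).Adj x y then f x - f y else 0) =
      (if (x : ℕ) + 1 = y then f x - f (x + 1) else 0) +
      (if (y : ℕ) + 1 = x then f x - f (x - 1) else 0) := by
    intro y
    rw [pathGraph_adj]
    by_cases h1 : (x : ℕ) + 1 = y
    · have h2 : ¬ (y : ℕ) + 1 = x := by omega
      simp [h1, h2]
    · by_cases h2 : (y : ℕ) + 1 = x
      · rw [if_pos (Or.inr h2), if_neg h1, if_pos h2, zero_add, ← h2, Nat.add_sub_cancel]
      · simp [h1, h2]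
  simp only [outflow, key, Finset.sum_add_distrib]
  have e1 : (∑ y : Fin (N + 1), if (x : ℕ) + 1 = y then f x - f (x + 1) else 0) =
      f x - f (x + 1) := by
    by_cases h : (x : ℕ) = N
    · rw [h, hf, sub_self]; simp
    · rw [Finset.sum_eq_single (⟨x + 1, by omega⟩ : Fin (N + 1))]
      · simp
      · intro b _ hb
        rw [if_neg]
        intro h'
        exact hb (Fin.ext h'.symm)
      · simp
  have e2 : (∑ y : Fin (N + 1), if (y : ℕ) + 1 = x then f x - f (x - 1) else 0) =
      f x - f (x - 1) := by
    by_cases h : (x : ℕ) = 0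
    · rw [h]; simp
    · rw [Finset.sum_eq_single (⟨x - 1, by omega⟩ : Fin (N + 1))]
      · rw [if_pos]; simp only; omega
      · intro b _ hb
        rw [if_neg]
        intro h'
        exact hb (Fin.ext (by simp only; omega))
      · simp
  rw [e1, e2]; ring

theorem outflow_cycleGraph_four (f : Fin 4 → ℝ) (y : Fin 4) :
    (cycleGraph 4).outflow f y = 2 * f y - f (y + 1) - f (y - 1) := by
  have key : ∀ a b : Fin 4, (cycleGraph 4).Adj a b ↔ b = a + 1 ∨ b = a - 1 := by decide
  have h0 : ∀ y : Fin 4, y + 1 ≠ y - 1 := by decide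
  have h : (cycleGraph 4).outflow f y = ∑ x : Fin 4,
      ((if x = y + 1 then f y - f x else 0) + (if x = y - 1 then f y - f x else 0)) := by
    refine Finset.sum_congr rfl fun x _ => ?_
    by_cases h : x = y + 1
    · simp [key, h, h0]
    · simp [key, h]
  simp only [h, Finset.sum_add_distrib, Finset.sum_ite_eq', Finset.mem_univ, if_true]
  ring

/-! ### Green's functions of the path -/

/-- The solution of `(L + r) c = 0` on the ray `0, 1, 2, …` with `c 0 = 1`. -/
noncomputable def raySolution (r : ℝ) : ℕ → ℝ
  | 0 => 1
  | 1 => 1 + r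
  | k + 2 => (2 + r) * raySolution r (k + 1) - raySolution r k

theorem raySolution_zero (r : ℝ) : raySolution r 0 = 1 := by rw [raySolution]
theorem raySolution_one (r : ℝ) : raySolution r 1 = 1 + r := by rw [raySolution]
theorem raySolution_add_two (r : ℝ) (k : ℕ) :
    raySolution r (k + 2) = (2 + r) * raySolution r (k + 1) - raySolution r k := by
  rw [raySolution]

/-- The recurrence in a form that includes the reflecting boundary (`0 - 1 = 0` in `ℕ`). -/
theorem raySolution_succ (r : ℝ) (k : ℕ) :
    raySolution r (k + 1) = (2 + r) * raySolution r k - raySolution r (k - 1) := by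
  cases k with
  | zero => simp [raySolution_zero, raySolution_one]; ring
  | succ k => exact raySolution_add_two r k

theorem raySolution_pos_and_growth {r : ℝ} (hr : 0 ≤ r) (k : ℕ) :
    0 < raySolution r k ∧ (1 + r) * raySolution r k ≤ raySolution r (k + 1) := by
  induction k with
  | zero => simp [raySolution_zero, raySolution_one]
  | succ k ih =>
    have : 0 < raySolution r (k + 1) := lt_of_lt_of_le (by nlinarith [ih.1]) ih.2
    refine ⟨this, ?_⟩
    rw [raySolution_add_two]
    nlinarith [ih.1, ih.2, mul_nonneg hr ih.1.le]

theorem raySolution_pos {r : ℝ} (hr : 0 ≤ r) (k : ℕ) : 0 < raySolution r k :=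
  (raySolution_pos_and_growth hr k).1

theorem raySolution_growth {r : ℝ} (hr : 0 ≤ r) (k : ℕ) :
    (1 + r) * raySolution r k ≤ raySolution r (k + 1) :=
  (raySolution_pos_and_growth hr k).2

theorem raySolution_monotone {r : ℝ} (hr : 0 ≤ r) : Monotone (raySolution r) :=
  monotone_nat_of_le_succ fun k => by
    nlinarith [raySolution_growth hr k, mul_nonneg hr (raySolution_pos hr k).le]

theorem raySolution_succ_le {r : ℝ} (hr : 0 ≤ r) (k : ℕ) :
    raySolution r (k + 1) ≤ (2 + r) * raySolution r k := by
  rw [raySolution_succ]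
  linarith [raySolution_pos hr (k - 1)]

/-- The crude ratio bound 4, fed back into the recurrence, gives `4 - 1/4 = 15/4`, close to the
limiting ratio `2 + √3`. -/
theorem raySolution_two_succ_le (k : ℕ) :
    4 * raySolution 2 (k + 1) ≤ 15 * raySolution 2 k := by
  cases k with
  | zero => rw [raySolution_one, raySolution_zero]; norm_num
  | succ k =>
    have := raySolution_succ_le (r := 2) (by norm_num) k
    rw [raySolution_add_two]
    linarith

/-- Feeding the ratio bound `1 + r` back into the recurrence improves it to 11/3 for `r = 2` and
29/5 for `r = 4`. -/
theorem raySolution_growth_succ {r : ℝ} (hr : 0 ≤ r) (k : ℕ) :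
    ((2 + r) * (1 + r) - 1) * raySolution r (k + 1) ≤ (1 + r) * raySolution r (k + 2) := by
  rw [raySolution_add_two]
  linarith [raySolution_growth hr k]

/-- A discrete Wronskian: by the recurrence, the left side depends only on `k + m`. It normalises
the Green's function. -/
theorem raySolution_wronskian (r : ℝ) (k m : ℕ) :
    raySolution r (k + 1) * raySolution r (m + 1) - raySolution r k * raySolution r m =
      raySolution r (k + m + 2) - raySolution r (k + m + 1) := by
  induction k generalizing m with
  | zero =>
    rw [raySolution_zero, raySolution_one, zero_add, raySolution_add_two]
    ring
  | succ k ih =>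
    have h := ih (m + 1)
    rw [show k + (m + 1) = k + 1 + m by ring] at h
    rw [← h, raySolution_add_two, raySolution_add_two]
    ring

/-- The Green's function `(L + r)⁻¹` of the path `0, 1, …, N`. -/
noncomputable def pathGreen (r : ℝ) (N x i : ℕ) : ℝ :=
  raySolution r (min x i) * raySolution r (N - max x i) /
    (raySolution r (N + 1) - raySolution r N)

theorem pathGreen_comm (r : ℝ) (N x i : ℕ) : pathGreen r N x i = pathGreen r N i x := by
  rw [pathGreen, pathGreen, min_comm, max_comm]

theorem raySolution_succ_sub_pos {r : ℝ} (hr : 0 < r) (N : ℕ) :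
    0 < raySolution r (N + 1) - raySolution r N := by
  nlinarith [raySolution_growth hr.le N, mul_pos hr (raySolution_pos hr.le N)]

theorem pathGreen_pos {r : ℝ} (hr : 0 < r) (N x i : ℕ) : 0 < pathGreen r N x i :=
  div_pos (mul_pos (raySolution_pos hr.le _) (raySolution_pos hr.le _))
    (raySolution_succ_sub_pos hr N)

theorem pathGreen_last {r : ℝ} {N i : ℕ} (hi : i ≤ N) :
    pathGreen r N (N + 1) i = pathGreen r N N i := by
  simp [pathGreen, hi, hi.trans (Nat.le_succ N)]

theorem pathGreen_equation {r : ℝ} (hr : 0 < r) {N : ℕ} (x i : Fin (N + 1)) :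
    (pathGraph (N + 1)).outflow (fun y => pathGreen r N y i) x + r * pathGreen r N x i =
      if x = i then 1 else 0 := by
  have hi := i.is_le
  have hx := x.is_le
  rw [outflow_pathGraph (fun y => pathGreen r N y i) (pathGreen_last hi)]
  simp only [Fin.ext_iff]
  obtain ⟨x, hx'⟩ := x
  obtain ⟨i, hi'⟩ := i
  simp only at hi hx ⊢
  have hW := (raySolution_succ_sub_pos hr N).ne'
  have rec1 := raySolution_succ r x
  have rec2 := raySolution_succ r (N - x)
  rcases lt_trichotomy x i with h | h | h
  · rw [if_neg h.ne]
    simp only [pathGreen]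
    rw [min_eq_left h.le, max_eq_right h.le, min_eq_left (by omega : x - 1 ≤ i),
      max_eq_right (by omega : x - 1 ≤ i), min_eq_left (by omega : x + 1 ≤ i),
      max_eq_right (by omega : x + 1 ≤ i), rec1]
    field_simp
    ring
  · subst h
    rw [if_pos rfl]
    simp only [pathGreen]
    have key : raySolution r (x + 1) * raySolution r (N - x) -
        raySolution r x * raySolution r (N - x - 1) =
        raySolution r (N + 1) - raySolution r N := by
      rcases hx.eq_or_lt with rfl | hlt
      · simp [raySolution_zero]
      · obtain ⟨m, rfl⟩ : ∃ m, N = x + m + 1 := ⟨N - x - 1, by omega⟩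
        rw [show x + m + 1 - x = m + 1 by omega, Nat.add_sub_cancel]
        exact raySolution_wronskian r x m
    rw [min_self, max_self, min_eq_left (by omega : x - 1 ≤ x),
      max_eq_right (by omega : x - 1 ≤ x), min_eq_right (by omega : x ≤ x + 1),
      max_eq_left (by omega : x ≤ x + 1), ← Nat.sub_sub]
    rw [← sub_eq_zero]
    field_simp
    rw [← key, rec1]
    ring
  · rw [if_neg h.ne']
    simp only [pathGreen]
    rw [min_eq_right h.le, max_eq_left h.le, min_eq_right (by omega : i ≤ x - 1),
      max_eq_left (by omega : i ≤ x - 1), min_eq_right (by omega : i ≤ x + 1),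
      max_eq_left (by omega : i ≤ x + 1), ← Nat.sub_sub,
      show N - (x - 1) = N - x + 1 by omega, rec2]
    field_simp
    ring

/-- The Green's function is strictly decreasing in the mass `r`. -/
theorem pathGreen_lt {r s : ℝ} (hr : 0 < r) (hrs : r < s) {N : ℕ} (x i : Fin (N + 1)) :
    pathGreen s N x i < pathGreen r N x i := by
  have hs := hr.trans hrs
  -- The difference `f` satisfies `(L + r) f = (s - r) * pathGreen s`, which is positive.
  have h := pos_of_outflow_add_nonneg (pathGraph (N + 1))
    (f := fun y => pathGreen r N y i - pathGreen s N y i) hr (fun w => ?_) x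
  · exact sub_pos.1 h
  have e1 := pathGreen_equation hr w i
  have e2 := pathGreen_equation hs w i
  have e3 : (pathGraph (N + 1)).outflow
      (fun y => pathGreen r N y i - pathGreen s N y i) w =
      (pathGraph (N + 1)).outflow (fun y => pathGreen r N y i) w -
      (pathGraph (N + 1)).outflow (fun y => pathGreen s N y i) w := by
    simp only [outflow, ← Finset.sum_sub_distrib]
    exact Finset.sum_congr rfl fun y _ => by split_ifs <;> ring
  rw [e3]
  nlinarith [mul_pos (sub_pos.2 hrs) (pathGreen_pos hs N w i)]

theorem pathGreen_second_difference {r : ℝ} (hr : 0 < r) {N x i : ℕ} (hx : x ≤ N) (hi : i ≤ N) :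
    2 * pathGreen r N x i - pathGreen r N (x - 1) i - pathGreen r N (x + 1) i +
      r * pathGreen r N x i = if x = i then 1 else 0 := by
  have h := pathGreen_equation hr (⟨x, by omega⟩ : Fin (N + 1)) ⟨i, by omega⟩
  rw [outflow_pathGraph (fun y => pathGreen r N y i) (pathGreen_last hi)] at h
  simpa using h

/-- This handles the massless mode, where `L` is not invertible: the potential falls with slope one
between source and sink and is constant outside. -/
theorem clamp_second_difference {i k : ℕ} (hik : i ≤ k) (x : ℕ) :
    -(2 * ((max i (min x k) : ℕ) : ℝ) - ((max i (min (x - 1) k) : ℕ) : ℝ) -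
      ((max i (min (x + 1) k) : ℕ) : ℝ)) = (if x = i then 1 else 0) - (if x = k then 1 else 0) := by
  have key : -(2 * ((max i (min x k) : ℕ) : ℤ) - ((max i (min (x - 1) k) : ℕ) : ℤ) -
      ((max i (min (x + 1) k) : ℕ) : ℤ)) =
      (if x = i then 1 else 0) - (if x = k then 1 else 0) := by
    split_ifs <;> omega
  exact_mod_cast key

/-! ### Fourier modes and the closed formula for the resistance -/

/-- `cos (π z / 2)` for `z` in `ℤ / 4`. -/
noncomputable def cosHalfPi : Fin 4 → ℝ := ![1, 0, -1, 0]

/-- `cos (π z)` for `z` in `ℤ / 4`. -/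
noncomputable def cosPi : Fin 4 → ℝ := ![1, -1, 1, -1]

theorem cosHalfPi_second_difference (z : Fin 4) :
    2 * cosHalfPi z - cosHalfPi (z + 1) - cosHalfPi (z - 1) = 2 * cosHalfPi z := by
  fin_cases z <;> simp [cosHalfPi]

theorem cosPi_second_difference (z : Fin 4) :
    2 * cosPi z - cosPi (z + 1) - cosPi (z - 1) = 4 * cosPi z := by
  fin_cases z <;> simp [cosPi] <;> norm_num

theorem cosHalfPi_neg (z : Fin 4) : cosHalfPi (-z) = cosHalfPi z := by
  fin_cases z <;> simp [cosHalfPi]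

theorem cosPi_neg (z : Fin 4) : cosPi (-z) = cosPi z := by
  fin_cases z <;> simp [cosPi]

/-- The Fourier expansion of a point source on `C_4`; the weight 2 is the multiplicity of the
eigenvalue 2. -/
theorem one_add_cos (z : Fin 4) :
    1 + 2 * cosHalfPi z + cosPi z = if z = 0 then 4 else 0 := by
  fin_cases z <;> simp [cosPi, cosHalfPi] <;> norm_num

/-- The potential on `P_{N+1} □ C_4` of a unit current from `(i, j)` to `(k, l)`, where `i ≤ k`. -/
noncomputable def towerPotential (N i k : ℕ) (j l : Fin 4) (x : ℕ) (y : Fin 4) : ℝ :=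
  1 / 4 * (-((max i (min x k) : ℕ) : ℝ) +
    2 * (cosHalfPi (y - j) * pathGreen 2 N x i - cosHalfPi (y - l) * pathGreen 2 N x k) +
    (cosPi (y - j) * pathGreen 4 N x i - cosPi (y - l) * pathGreen 4 N x k))

theorem towerPotential_isUnitCurrentPotential {N i k : ℕ} (hik : i ≤ k) (hk : k ≤ N)
    (j l : Fin 4) :
    (blockTower (N + 1)).IsUnitCurrentPotential (⟨i, by omega⟩, j) (⟨k, by omega⟩, l)
      (fun p => towerPotential N i k j l p.1 p.2) := by
  classical
  have hi := hik.trans hk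
  rintro ⟨x, y⟩
  have hx := x.is_le
  have e : (blockTower (N + 1)).outflow (fun p => towerPotential N i k j l p.1 p.2) (x, y) = _ :=
    outflow_boxProd _ _ _ _
  have hlast : towerPotential N i k j l (N + 1) y = towerPotential N i k j l N y := by
    rw [towerPotential, towerPotential, pathGreen_last hi, pathGreen_last hi,
      pathGreen_last hk, pathGreen_last hk, min_eq_right hk, min_eq_right (by omega)]
  have e' := outflow_pathGraph (fun x => towerPotential N i k j l x y) hlast x
  simp only at e
  rw [e', outflow_cycleGraph_four] at e
  refine Eq.trans ?_ (e.trans ?_)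
  · exact Finset.sum_congr rfl fun _ _ => by congr
  simp only [Prod.mk.injEq, Fin.ext_iff (a := x)]
  have g (r : ℝ) (hr : 0 < r) (m : ℕ) (hm : m ≤ N) := pathGreen_second_difference hr hx hm
  have d (m : ℕ) (z : Fin 4) : (if (x : ℕ) = m ∧ y = z then (1 : ℝ) else 0) =
      1 / 4 * (if (x : ℕ) = m then 1 else 0) * (1 + 2 * cosHalfPi (y - z) + cosPi (y - z)) := by
    rw [one_add_cos]
    by_cases h1 : (x : ℕ) = m <;> by_cases h2 : y = z <;> simp [h1, h2, sub_eq_zero]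
  have c1 (z : Fin 4) := cosHalfPi_second_difference (y - z)
  have c2 (z : Fin 4) := cosPi_second_difference (y - z)
  rw [d, d]
  simp only [towerPotential, add_sub_right_comm, sub_right_comm y 1]
  have h0 := clamp_second_difference hik x
  linear_combination 1 / 4 * h0 +
    1 / 2 * cosHalfPi (y - j) * g 2 (by norm_num) i hi -
    1 / 2 * cosHalfPi (y - l) * g 2 (by norm_num) k hk +
    1 / 4 * cosPi (y - j) * g 4 (by norm_num) i hi -
    1 / 4 * cosPi (y - l) * g 4 (by norm_num) k hk +
    1 / 2 * pathGreen 2 N x i * c1 j - 1 / 2 * pathGreen 2 N x k * c1 l +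
    1 / 4 * pathGreen 4 N x i * c2 j - 1 / 4 * pathGreen 4 N x k * c2 l

/-- Four times the resistance distance between `(i, y)` and `(k, y + z)`, where `i ≤ k`. -/
noncomputable def towerResistance (N i k : ℕ) (z : Fin 4) : ℝ :=
  (k : ℝ) - i +
    2 * (pathGreen 2 N i i + pathGreen 2 N k k - 2 * cosHalfPi z * pathGreen 2 N i k) +
    (pathGreen 4 N i i + pathGreen 4 N k k - 2 * cosPi z * pathGreen 4 N i k)

theorem resistanceDist_blockTower {N i k : ℕ} (hik : i ≤ k) (hk : k ≤ N) (j l : Fin 4) :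
    (blockTower (N + 1)).resistanceDist (⟨i, by omega⟩, j) (⟨k, by omega⟩, l) =
      1 / 4 * towerResistance N i k (l - j) := by
  rw [resistanceDist_eq (blockTower_connected _ (by omega))
    (towerPotential_isUnitCurrentPotential hik hk j l)]
  have h1 : cosHalfPi (j - l) = cosHalfPi (l - j) := by rw [← cosHalfPi_neg, neg_sub]
  have h2 : cosPi (j - l) = cosPi (l - j) := by rw [← cosPi_neg, neg_sub]
  have h3 : cosHalfPi 0 = 1 := rfl
  have h4 : cosPi 0 = 1 := rfl
  simp only [towerPotential, towerResistance, sub_self, h1, h2, h3, h4, pathGreen_comm _ _ k i,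
    min_eq_left hik, max_self, min_self, max_eq_right hik]
  ring

theorem resistanceDist_comm {V : Type*} [Fintype V] {G : SimpleGraph V} (hG : G.Connected)
    (u v : V) : G.resistanceDist u v = G.resistanceDist v u := by
  obtain ⟨φ, hφ⟩ := exists_isUnitCurrentPotential hG u v
  have h : G.IsUnitCurrentPotential v u (-φ) := by
    rw [isUnitCurrentPotential_iff] at hφ ⊢
    rw [Matrix.mulVec_neg, hφ, neg_sub]
  rw [resistanceDist_eq hG hφ, resistanceDist_eq hG h]
  simp only [Pi.neg_apply]
  ring

/-! ### Maximising the resistance -/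

theorem towerResistance_lt_of_ne_two {N i k : ℕ} (hi : i ≤ N) (hk : k ≤ N) {z : Fin 4}
    (hz : z ≠ 2) : towerResistance N i k z < towerResistance N i k 2 := by
  have h2 := pathGreen_pos (r := 2) (by norm_num) N i k
  have h4 : pathGreen 4 N i k < pathGreen 2 N i k :=
    pathGreen_lt (r := 2) (s := 4) (by norm_num) (by norm_num)
      (⟨i, by omega⟩ : Fin (N + 1)) ⟨k, by omega⟩
  fin_cases z <;> simp [towerResistance, cosHalfPi, cosPi] at hz ⊢ <;> linarith

/-- The reflection of the path preserves resistances. -/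
theorem towerResistance_reflect {N i k : ℕ} (hik : i ≤ k) (hk : k ≤ N) (z : Fin 4) :
    towerResistance N (N - k) (N - i) z = towerResistance N i k z := by
  have hg (r : ℝ) {a b : ℕ} (hab : a ≤ b) (hb : b ≤ N) :
      pathGreen r N (N - b) (N - a) = pathGreen r N a b := by
    rw [pathGreen, pathGreen, min_eq_left (by omega), max_eq_right (by omega), min_eq_left hab,
      max_eq_right hab, show N - (N - a) = a by omega, mul_comm]
  simp only [towerResistance, hg _ hik hk, hg _ le_rfl hk, hg _ le_rfl (hik.trans hk)]
  push_cast [hk, hik.trans hk]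
  ring

/-- The Wronskian rewrites each denominator in the same four values as its numerator, so that bounds
on consecutive ratios suffice to estimate the quotients. -/
theorem towerResistance_two_succ_sub {i k m : ℕ} (hik : i ≤ k) :
    towerResistance (k + m + 1) i (k + 1) 2 - towerResistance (k + m + 1) i k 2 = 1 +
      (2 * (raySolution 2 (k + 1) * raySolution 2 m - raySolution 2 k * raySolution 2 (m + 1)) -
        4 * raySolution 2 i * (raySolution 2 (m + 1) - raySolution 2 m)) /
        (raySolution 2 (k + 1) * raySolution 2 (m + 1) - raySolution 2 k * raySolution 2 m) +
      ((raySolution 4 (k + 1) * raySolution 4 m - raySolution 4 k * raySolution 4 (m + 1)) +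
        2 * raySolution 4 i * (raySolution 4 (m + 1) - raySolution 4 m)) /
        (raySolution 4 (k + 1) * raySolution 4 (m + 1) - raySolution 4 k * raySolution 4 m) := by
  have e1 : cosHalfPi 2 = -1 := rfl
  have e2 : cosPi 2 = 1 := rfl
  rw [raySolution_wronskian, raySolution_wronskian]
  simp only [towerResistance, e1, e2, pathGreen, min_self, max_self, min_eq_left hik,
    max_eq_right hik, min_eq_left (hik.trans k.le_succ), max_eq_right (hik.trans k.le_succ),
    show k + m + 1 - k = m + 1 by omega, show k + m + 1 - (k + 1) = m by omega]
  push_cast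
  ring

theorem towerResistance_two_lt_succ {i k m : ℕ} (hik : i ≤ k) :
    towerResistance (k + m + 1) i k 2 < towerResistance (k + m + 1) i (k + 1) 2 := by
  rw [← sub_pos, towerResistance_two_succ_sub hik]
  have t2 : (0 : ℝ) ≤ 2 := by norm_num
  have t4 : (0 : ℝ) ≤ 4 := by norm_num
  have b2 := raySolution_pos t2 m
  have b4 := raySolution_pos t4 m
  have u2 := raySolution_two_succ_le m
  have u4 := raySolution_succ_le t4 m
  have l2 := raySolution_growth t2 m
  have l4 := raySolution_growth t4 m
  cases k with
  | zero =>
    obtain rfl : i = 0 := by omega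
    simp only [raySolution_zero, raySolution_one, zero_add]
    -- At the bottom level the mass-2 loss can exceed the gain 1 in distance; the mass-4 term
    -- compensates: `1 - 1.22 + 0.30 > 0`.
    have h2 : (-22 / 100 - 1 : ℝ) ≤ (2 * ((1 + 2) * raySolution 2 m - 1 * raySolution 2 (m + 1)) -
        4 * 1 * (raySolution 2 (m + 1) - raySolution 2 m)) /
        ((1 + 2) * raySolution 2 (m + 1) - 1 * raySolution 2 m) := by
      rw [le_div_iff₀ (by linarith)]
      linarith
    have h4 : (30 / 100 : ℝ) ≤ (((1 + 4) * raySolution 4 m - 1 * raySolution 4 (m + 1)) +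
        2 * 1 * (raySolution 4 (m + 1) - raySolution 4 m)) /
        ((1 + 4) * raySolution 4 (m + 1) - 1 * raySolution 4 m) := by
      rw [le_div_iff₀ (by linarith)]
      linarith
    linarith
  | succ k =>
    have s2 := raySolution_growth_succ t2 k
    have s4 := raySolution_growth_succ t4 k
    have a2 := raySolution_pos t2 (k + 1)
    have a4 := raySolution_pos t4 (k + 1)
    have p2 := raySolution_monotone t2 hik
    have p4 := raySolution_pos t4 i
    generalize raySolution 2 (k + 1) = a at *
    generalize raySolution 2 (k + 1 + 1) = a' at *
    generalize raySolution 4 (k + 1) = c at *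
    generalize raySolution 4 (k + 1 + 1) = c' at *
    generalize raySolution 2 m = b at *
    generalize raySolution 2 (m + 1) = b' at *
    generalize raySolution 4 m = d at *
    generalize raySolution 4 (m + 1) = d' at *
    generalize raySolution 2 i = p at *
    generalize raySolution 4 i = q at *
    -- Higher up, the improved ratios 11/3 and 29/5 apply, and `1 - 0.9 - 0.05 > 0`. Here `p` is
    -- replaced by its bound `a`, and the term in `q` is only used to be nonnegative.
    have h2 : (1 / 10 - 1 : ℝ) ≤ (2 * (a' * b - a * b') - 4 * p * (b' - b)) / (a' * b' - a * b) := by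
      rw [le_div_iff₀ (by nlinarith)]
      -- Products of the ratio bounds in `k` and in `m`: they make the bilinear inequality linear
      -- for `linarith`.
      have f1 : 0 ≤ (3 * a' - 11 * a) * (15 * b - 4 * b') :=
        mul_nonneg (by linarith) (by linarith)
      have f2 : 0 ≤ (3 * a' - 11 * a) * b := mul_nonneg (by linarith) b2.le
      have f3 : 0 ≤ a * (15 * b - 4 * b') := mul_nonneg a2.le (by linarith)
      have f4 := mul_pos a2 b2
      have f5 : 0 ≤ (a - p) * (b' - b) := mul_nonneg (by linarith) (by linarith)
      have f6 : 0 ≤ (3 * a' - 11 * a) * (b' - 3 * b) := mul_nonneg (by linarith) (by linarith)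
      linarith
    have h4 : (-1 / 20 : ℝ) ≤
        ((c' * d - c * d') + 2 * q * (d' - d)) / (c' * d' - c * d) := by
      rw [le_div_iff₀ (by nlinarith)]
      have f1 : 0 ≤ (5 * c' - 29 * c) * (6 * d - d') := mul_nonneg (by linarith) (by linarith)
      have f2 : 0 ≤ (5 * c' - 29 * c) * d := mul_nonneg (by linarith) b4.le
      have f3 : 0 ≤ c * (6 * d - d') := mul_nonneg a4.le (by linarith)
      have f4 := mul_pos a4 b4
      have f5 : 0 ≤ q * (d' - d) := mul_nonneg p4.le (by linarith)
      have f6 : 0 ≤ (5 * c' - 29 * c) * (d' - 5 * d) := mul_nonneg (by linarith) (by linarith)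
      linarith
    linarith

theorem towerResistance_two_lt {N i k l : ℕ} (hik : i ≤ k) (hkl : k < l) (hl : l ≤ N) :
    towerResistance N i k 2 < towerResistance N i l 2 := by
  induction l, hkl using Nat.le_induction with
  | base =>
    obtain ⟨m, rfl⟩ : ∃ m, N = k + m + 1 := ⟨N - k - 1, by omega⟩
    exact towerResistance_two_lt_succ hik
  | succ l hkl ih =>
    obtain ⟨m, rfl⟩ : ∃ m, N = l + m + 1 := ⟨N - l - 1, by omega⟩
    exact (ih (by omega)).trans (towerResistance_two_lt_succ (by omega))

theorem towerResistance_two_le_ends {N i k : ℕ} (hik : i ≤ k) (hk : k ≤ N) :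
    towerResistance N i k 2 ≤ towerResistance N 0 N 2 ∧
      (towerResistance N i k 2 = towerResistance N 0 N 2 → i = 0 ∧ k = N) := by
  have h1 (h : k < N) := towerResistance_two_lt hik h le_rfl
  have h2 (h : 0 < i) : towerResistance N i N 2 < towerResistance N 0 N 2 := by
    -- Reflection turns the pair `(i, N)` into `(0, N - i)`, whose upper level can then be moved to
    -- `N`.
    have hr := towerResistance_reflect (hik.trans hk) (le_refl N) 2
    rw [Nat.sub_self] at hr
    rw [← hr]
    exact towerResistance_two_lt (Nat.zero_le _) (by omega) le_rfl
  rcases hk.eq_or_lt with rfl | hk <;> rcases Nat.eq_zero_or_pos i with rfl | hi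
  · simp
  · exact ⟨(h2 hi).le, fun h => absurd h (h2 hi).ne⟩
  · exact ⟨(h1 hk).le, fun h => absurd h (h1 hk).ne⟩
  · have := (h1 hk).trans (h2 hi)
    exact ⟨this.le, fun h => absurd h this.ne⟩

theorem towerResistance_le_ends {N i k : ℕ} (hik : i ≤ k) (hk : k ≤ N) (z : Fin 4) :
    towerResistance N i k z ≤ towerResistance N 0 N 2 ∧
      (towerResistance N i k z = towerResistance N 0 N 2 → i = 0 ∧ k = N ∧ z = 2) := by
  obtain ⟨h1, h2⟩ := towerResistance_two_le_ends hik hk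
  by_cases hz : z = 2
  · subst hz
    exact ⟨h1, fun h => ⟨(h2 h).1, (h2 h).2, rfl⟩⟩
  · have := (towerResistance_lt_of_ne_two (hik.trans hk) hk hz).trans_le h1
    exact ⟨this.le, fun h => absurd h this.ne⟩

/-! ### The diameter and the diametrical pairs -/

theorem resistanceDist_blockTower_ends (N : ℕ) (j : Fin 4) :
    (blockTower (N + 1)).resistanceDist (⟨0, by omega⟩, j) (⟨N, by omega⟩, j + 2) =
      1 / 4 * towerResistance N 0 N 2 := by
  rw [resistanceDist_blockTower (Nat.zero_le N) le_rfl, add_sub_cancel_left]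

theorem resistanceDiam_blockTower (N : ℕ) :
    (blockTower (N + 1)).resistanceDiam = 1 / 4 * towerResistance N 0 N 2 := by
  refine le_antisymm (ciSup_le ?_) ?_
  · have key {u v : Fin (N + 1) × Fin 4} (h : u.1 ≤ v.1) :
        (blockTower (N + 1)).resistanceDist u v ≤ 1 / 4 * towerResistance N 0 N 2 := by
      have e := resistanceDist_blockTower h v.1.is_le u.2 v.2
      have := (towerResistance_le_ends h v.1.is_le (v.2 - u.2)).1
      exact e.trans_le (by linarith)
    rintro ⟨u, v⟩
    rcases le_total u.1 v.1 with h | h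
    · exact key h
    · rw [resistanceDist_comm (blockTower_connected _ (by omega))]
      exact key h
  · rw [← resistanceDist_blockTower_ends N 0]
    exact le_ciSup (f := fun p : (Fin (N + 1) × Fin 4) × (Fin (N + 1) × Fin 4) =>
      (blockTower (N + 1)).resistanceDist p.1 p.2) (Set.finite_range _).bddAbove (_, _)

theorem mem_resistanceDiametricalPairs_blockTower (N : ℕ) (e : Sym2 (Fin (N + 1) × Fin 4)) :
    e ∈ (blockTower (N + 1)).resistanceDiametricalPairs ↔
      ∃ j : Fin 4, e = s((⟨0, by omega⟩, j), (⟨N, by omega⟩, j + 2)) := by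
  constructor
  · rintro ⟨u, v, rfl, h⟩
    wlog huv : u.1 ≤ v.1 generalizing u v
    · rw [Sym2.eq_swap]
      exact this v u (by rwa [resistanceDist_comm (blockTower_connected _ (by omega))])
        (le_of_not_ge huv)
    have e := resistanceDist_blockTower huv v.1.is_le u.2 v.2
    rw [resistanceDiam_blockTower] at h
    have h' : towerResistance N u.1 v.1 (v.2 - u.2) = towerResistance N 0 N 2 := by
      have := e.symm.trans h
      linarith
    obtain ⟨h1, h2, h3⟩ := (towerResistance_le_ends huv v.1.is_le _).2 h'
    refine ⟨u.2, ?_⟩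
    rw [← h3, add_sub_cancel]
    congr 2
    · exact Prod.ext (Fin.ext h1) rfl
    · exact Prod.ext (Fin.ext h2) rfl
  · rintro ⟨j, rfl⟩
    exact ⟨_, _, rfl, by rw [resistanceDist_blockTower_ends, resistanceDiam_blockTower]⟩

end SimpleGraph

theorem theorem4p3 (n : ℕ) (hn : 2 ≤ n) :
    (SimpleGraph.blockTower n).resistanceDiametricalPairs =
      {s((⟨0, by omega⟩, 0), (⟨n - 1, by omega⟩, 2)),
       s((⟨0, by omega⟩, 1), (⟨n - 1, by omega⟩, 3)),
       s((⟨0, by omega⟩, 2), (⟨n - 1, by omega⟩, 0)),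
       s((⟨0, by omega⟩, 3), (⟨n - 1, by omega⟩, 1))} := by
  obtain ⟨N, rfl⟩ : ∃ N, n = N + 1 := ⟨n - 1, by omega⟩
  ext e
  rw [SimpleGraph.mem_resistanceDiametricalPairs_blockTower]
  simp only [Fin.exists_fin_succ, IsEmpty.exists_iff, or_false, Set.mem_insert_iff,
    Set.mem_singleton_iff]
  rfl
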